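/- **Setting.** Let $(\Omega,\mathcal A,\mu)$ be a probability space and let $T:\Omega\to\Omega$ be measurable, preserve $\mu$, and be mixing, i.e. $\mu(A\cap T^{-n}B)\to\mu(A)\mu(B)$ for all $A,B\in\mathcal A$. Let $\widehat T$ be the transfer operator of $T$ on $L^1(\mu)$, determined by $\int \widehat T f\cdot g\,d\mu=\int f\cdot g\circ T\,d\mu$ for all $f\in L^1(\mu)$, $g\in L^\infty(\mu)$. Let $(\mathcal F,\|\cdot\|)$ be a complex Banach algebra of (classes modulo null sets of) measurable functions $\Omega\to\mathbb C$ with pointwise operations, which contains the constants and satisfies $\|\varphi\|\ge|\varphi|_\infty$ (essential supremum) for all $\varphi\in\mathcal F$. Assume that $\widehat T$ maps $\mathcal F$ into $\mathcal F$, is bounded for $\|\cdot\|$, and has a spectral gap on $\mathcal F$: $\widehat T|_{\mathcal F}=\lambda P+N$ with $\lambda\in\mathbb C$ and bounded linear operators $P,N$ on $\mathcal F$ such that $P^2=P$, $\dim\operatorname{Im}P=1$, $PN=NP=0$, and the spectral radius of $N$ satisfies $\rho(N)<|\lambda|$. Let $\chi:\Omega\to\mathbb R_{\ge0}$ be measurable,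 put ${}^{\ell}\chi:=\chi\cdot\mathbf 1_{\{\chi\le\ell\}}$, and assume that there are constants $K_1,K_2>0$ such that for every $\ell>0$ the functions ${}^{\ell}\chi$ and $\mathbf 1_{\{\chi>\ell\}}$ belong to $\mathcal F$ with $\|{}^{\ell}\chi\|\le K_1\ell$ and $\|\mathbf 1_{\{\chi>\ell\}}\|\le K_2$. (All these assumptions together are called Property $\mathfrak D$.) Write $F(x)=\mu(\chi\le x)$ and, for $r>0$ and $n\in\mathbb N$, $\mathsf T_n^{r}\chi:=\sum_{k=0}^{n-1}({}^{r}\chi)\circ T^k$. **Theorem.** Let $(f_n)_{n\ge1}$ be a sequence of positive real numbers with $F(f_n)>0$ for all $n$. Assume that there is a function $\psi:\mathbb N\to(0,\infty)$ with $\sum_{n\ge1}1/\psi(n)<\infty$ such that $$f_n=o\!\left(\frac{\int\mathsf T_n^{f_n}\chi\,d\mu}{\log\psi(n)}\right)\qquad(n\to\infty),$$ equivalently, $\int{}^{f_n}\chi\,d\mu>0$ for all large $n$ and $\dfrac{f_n}{\int{}^{f_n}\chi\,d\mu}=o\!\left(\dfrac{n}{\log\psi(n)}\right)$. Then $$\lim_{n\to\infty}\frac{\mathsf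 T_n^{f_n}\chi}{\int\mathsf T_n^{f_n}\chi\,d\mu}=1\qquad\mu\text{-almost surely.}$$ -/

import Mathlib

open MeasureTheory Filter Topology Asymptotics
open scoped ENNReal

/-- A bounded operator `U` on a complex Banach space has a spectral gap: `U = c P + N` with `P` a
projection of rank one, `P N = N P = 0` and the spectral radius of `N` smaller than `|c|`. -/
def HasSpectralGap {E : Type*} [NormedAddCommGroup E] [NormedSpace ℂ E] (U : E →L[ℂ] E) : Prop :=
  ∃ (c : ℂ) (P N : E →L[ℂ] E),
    U = c • P + N ∧
    P * P = P ∧ Module.finrank ℂ (LinearMap.range (P : E →ₗ[ℂ] E)) = 1 ∧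
    spectralRadius ℂ N < ‖c‖ₑ ∧
    P * N = 0 ∧ N * P = 0

/-- `h` is the image of the integrable function `f` under the transfer operator of `T`: the
(a.e. unique) integrable `h` with `∫ h g dμ = ∫ f (g ∘ T) dμ` for every `g ∈ L^∞`. -/
def IsTransferOf {Ω : Type*} [MeasurableSpace Ω] (μ : Measure Ω) (T : Ω → Ω)
    (f h : Ω → ℂ) : Prop :=
  Integrable f μ ∧ Integrable h μ ∧
    ∀ g : Ω → ℂ, MemLp g ∞ μ → ∫ ω, h ω * g ω ∂μ = ∫ ω, f ω * g (T ω) ∂μ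

/-- The relation defining the transfer operator has at most one solution up to null sets. -/
theorem IsTransferOf.ae_eq {Ω : Type*} [MeasurableSpace Ω] {μ : Measure Ω} {T : Ω → Ω}
    {f h h' : Ω → ℂ} (H : IsTransferOf μ T f h) (H' : IsTransferOf μ T f h') : h =ᵐ[μ] h' := by
  refine Integrable.ae_eq_of_forall_setIntegral_eq h h' H.2.1 H'.2.1 fun s hs _ => ?_
  have hg : MemLp (s.indicator fun _ => (1 : ℂ)) ∞ μ :=
    (memLp_top_const (1 : ℂ)).indicator hs
  have key : ∀ u : Ω → ℂ,
      ∫ ω, u ω * s.indicator (fun _ => (1 : ℂ)) ω ∂μ = ∫ ω in s, u ω ∂μ := by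
    intro u
    rw [← integral_indicator hs]
    congr 1
    ext ω
    by_cases hω : ω ∈ s <;> simp [hω]
  rw [← key h, ← key h', H.2.2 _ hg, H'.2.2 _ hg]

/-- `T` preserves `μ` and `μ` is mixing: `μ (A ∩ T⁻ⁿ B) → μ A * μ B` for all measurable `A`, `B`. -/
structure IsMixing {Ω : Type*} [MeasurableSpace Ω] (μ : Measure Ω) (T : Ω → Ω) : Prop where
  invariant : MeasurePreserving T μ μ
  mixing : ∀ A B : Set Ω, MeasurableSet A → MeasurableSet B →
    Tendsto (fun n : ℕ => μ (A ∩ T^[n] ⁻¹' B)) atTop (𝓝 (μ A * μ B))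

/-- `ι` identifies the algebra `𝓕` with an algebra of (a.e. classes of) measurable complex-valued
functions, with pointwise operations, containing the constants. -/
structure IsFunctionAlgebra {Ω : Type*} [MeasurableSpace Ω] {μ : Measure Ω} {𝓕 : Type*}
    [NormedCommRing 𝓕] [NormedAlgebra ℂ 𝓕] (ι : 𝓕 →ₗ[ℂ] (Ω →ₘ[μ] ℂ)) : Prop where
  injective : Function.Injective ι
  map_mul : ∀ φ ψ : 𝓕, ι (φ * ψ) = ι φ * ι ψ
  map_one : ι 1 = 1

/-- Property `C` of the system `(Ω, T, μ, 𝓕, ‖·‖)`, where the Banach algebra `𝓕` (complete for its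
norm) is regarded through `ι` as an algebra of measurable functions. -/
structure PropertyC {Ω : Type*} [MeasurableSpace Ω] (μ : Measure Ω) [IsProbabilityMeasure μ]
    (T : Ω → Ω) {𝓕 : Type*} [NormedCommRing 𝓕] [NormedAlgebra ℂ 𝓕] [CompleteSpace 𝓕]
    (ι : 𝓕 →ₗ[ℂ] (Ω →ₘ[μ] ℂ)) : Prop where
  isMixing : IsMixing μ T
  functionAlgebra : IsFunctionAlgebra ι
  /-- The norm of `𝓕` dominates the essential supremum. -/
  essSup_le_norm : ∀ φ : 𝓕, eLpNorm (ι φ) ∞ μ ≤ ‖φ‖ₑ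
  /-- The transfer operator acts on `𝓕` as a bounded operator with a spectral gap. -/
  transfer : ∃ L : 𝓕 →L[ℂ] 𝓕,
    (∀ φ : 𝓕, IsTransferOf μ T (ι φ) (ι (L φ))) ∧ HasSpectralGap L

/-- The truncated observable `χ · 1_{χ ≤ ℓ}`. -/
noncomputable def trunc {Ω : Type*} (χ : Ω → ℝ) (ℓ : ℝ) : Ω → ℝ :=
  {ω | χ ω ≤ ℓ}.indicator χ

/-- Property `D` of the system `(Ω, T, μ, 𝓕, ‖·‖, χ)`. The observable itself may be unbounded, so
that only its truncations and the indicators of its level sets have to belong to `𝓕`. -/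
structure PropertyD {Ω : Type*} [MeasurableSpace Ω] (μ : Measure Ω) [IsProbabilityMeasure μ]
    (T : Ω → Ω) {𝓕 : Type*} [NormedCommRing 𝓕] [NormedAlgebra ℂ 𝓕] [CompleteSpace 𝓕]
    (ι : 𝓕 →ₗ[ℂ] (Ω →ₘ[μ] ℂ)) (χ : Ω → ℝ) : Prop where
  propertyC : PropertyC μ T ι
  measurable : Measurable χ
  nonneg : ∀ ω, 0 ≤ χ ω
  norm_trunc : ∃ K₁ : ℝ, 0 < K₁ ∧ ∀ ℓ : ℝ, 0 < ℓ →
    ∃ φ : 𝓕, ι φ =ᵐ[μ] (fun ω => (trunc χ ℓ ω : ℂ)) ∧ ‖φ‖ ≤ K₁ * ℓ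
  norm_indicator : ∃ K₂ : ℝ, 0 < K₂ ∧ ∀ ℓ : ℝ, 0 < ℓ →
    ∃ φ : 𝓕, ι φ =ᵐ[μ] {ω | ℓ < χ ω}.indicator (fun _ => (1 : ℂ)) ∧ ‖φ‖ ≤ K₂

/-- The truncated Birkhoff sum `∑_{k < n} (χ · 1_{χ ≤ r}) ∘ T^k`. -/
noncomputable def truncSum {Ω : Type*} (T : Ω → Ω) (χ : Ω → ℝ) (r : ℝ) (n : ℕ) : Ω → ℝ :=
  birkhoffSum T (trunc χ r) n

/-! The heart is a Chernoff bound with exponent proportional to the mean: with `E n` the mean of the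
truncated sum, a relative deviation `ε` has probability at most `2 exp (-c * E n / f n)`, where `c`
depends on `ε` and the system but not on `n`. The growth hypothesis makes this at most `2 / ψ n`
eventually, and Borel–Cantelli concludes.

To prove the bound, let `w` be the truncated observable divided by `f n`. It takes values in `[0,
1]`, and its representatives `φ` in `𝓕` are bounded uniformly in `n`. The product of the `1 + t * w
∘ T^k` replaces the exponential; its integral is the mean of an iterate of `u ↦ L ((1 + t φ) u)` at
`1`. Since `L` is the mean plus an operator contracting in an adapted norm, the iterates stay in a
cone around the constants of aperture `O(t)`, and each step multiplies the modulus of the mean by at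
most `exp (p * (t + B * t ^ 2))`, `p = ∫ w`. The factor `p` in the quadratic term keeps the bound
useful when `p` tends to `0`; it comes from `w ≥ 0` and the domination of the supremum by the norm.
-/

/-! ### Adapted norms and cone estimates -/

/-- An operator of spectral radius smaller than `1` is a strict contraction for an equivalent
norm. -/
theorem exists_adapted_norm {E : Type*} [NormedAddCommGroup E] [NormedSpace ℂ E] [CompleteSpace E]
    (N : E →L[ℂ] E) (hN : spectralRadius ℂ N < 1) :
    ∃ (r C : ℝ) (q : E → ℝ), 0 < r ∧ r < 1 ∧ 0 < C ∧ (∀ v w, q (v + w) ≤ q v + q w) ∧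
      (∀ v, ‖v‖ ≤ q v) ∧ (∀ v, q v ≤ C * ‖v‖) ∧ ∀ v, q (N v) ≤ r * q v := by
  obtain ⟨r', hr', hr1'⟩ := ENNReal.lt_iff_exists_nnreal_btwn.1 hN
  have hr1 : (r' : ℝ) < 1 := by exact_mod_cast hr1'
  have hr0 : 0 < (r' : ℝ) := by
    have : (0 : ℝ≥0∞) < r' := bot_le.trans_lt hr'
    exact_mod_cast this
  -- Gelfand's formula gives one power `m ≥ 1` with `‖N ^ m‖ ≤ r ^ m`; the weighted sum of the first
  -- `m` orbit norms is then the adapted norm.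
  have ev := (spectrum.pow_nnnorm_pow_one_div_tendsto_nhds_spectralRadius N).eventually
    (gt_mem_nhds hr')
  obtain ⟨m, hm, hm1⟩ := (ev.and (eventually_ge_atTop 1)).exists
  have hm0 : (m : ℝ) ≠ 0 := by positivity
  have hNm : ‖N ^ m‖ ≤ (r' : ℝ) ^ m := by
    have h2 := ENNReal.rpow_le_rpow hm.le (Nat.cast_nonneg (α := ℝ) m)
    rw [← ENNReal.rpow_mul, one_div, inv_mul_cancel₀ hm0, ENNReal.rpow_one,
      ENNReal.rpow_natCast] at h2
    exact_mod_cast h2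
  generalize hr : (r' : ℝ) = r at *
  refine ⟨r, ∑ k ∈ Finset.range m, r⁻¹ ^ k * ‖N ^ k‖ + 1,
    fun v => ∑ k ∈ Finset.range m, r⁻¹ ^ k * ‖(N ^ k) v‖, hr0, hr1, by positivity,
    ?_, ?_, ?_, ?_⟩
  · intro v w
    rw [← Finset.sum_add_distrib]
    refine Finset.sum_le_sum fun k _ => ?_
    rw [map_add, ← mul_add]
    gcongr
    exact norm_add_le _ _
  · intro v
    refine le_trans ?_ (Finset.single_le_sum (f := fun k => r⁻¹ ^ k * ‖(N ^ k) v‖)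
      (fun k _ => by positivity) (Finset.mem_range.2 (show 0 < m by omega)))
    simp
  · intro v
    rw [add_mul, Finset.sum_mul]
    refine le_trans (Finset.sum_le_sum fun k _ => ?_) (le_add_of_nonneg_right (by positivity))
    rw [mul_assoc]
    gcongr
    exact (N ^ k).le_opNorm v
  · intro v
    have e : ∀ k, r⁻¹ ^ k * ‖(N ^ k) (N v)‖ = r * (r⁻¹ ^ (k + 1) * ‖(N ^ (k + 1)) v‖) := by
      intro k
      rw [pow_succ N k, mul_apply_eq_comp, pow_succ r⁻¹]
      field_simp
    simp only [e]
    rw [← Finset.mul_sum]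
    refine mul_le_mul_of_nonneg_left ?_ hr0.le
    -- Applying `N` shifts the sum: the term `k = 0`, equal to `‖v‖`, is exchanged for the term `k =
    -- m`, which is no larger.
    have h1 := Finset.sum_range_succ (fun k => r⁻¹ ^ k * ‖(N ^ k) v‖) m
    have h2 := Finset.sum_range_succ' (fun k => r⁻¹ ^ k * ‖(N ^ k) v‖) m
    have h3 : r⁻¹ ^ m * ‖(N ^ m) v‖ ≤ ‖v‖ := by
      calc r⁻¹ ^ m * ‖(N ^ m) v‖ ≤ r⁻¹ ^ m * (r ^ m * ‖v‖) := by
            gcongr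
            exact (N ^ m).le_of_opNorm_le hNm v
        _ = ‖v‖ := by rw [← mul_assoc, ← mul_pow, inv_mul_cancel₀ hr0.ne', one_pow, one_mul]
    simp only [pow_zero, one_mul, one_apply_eq_self] at h2
    linarith

/-- Growth of the means of the iterates of `u ↦ L ((1 + t φ) u)`, where `L = I(·) 1 + N` and `N`
contracts: the second order term is proportional to the mean `p` of `φ`. -/
theorem exists_norm_iterate_le {𝓕 : Type*} [NormedCommRing 𝓕] [NormedAlgebra ℂ 𝓕]
    (L N : 𝓕 →L[ℂ] 𝓕) (I : 𝓕 →ₗ[ℂ] ℂ) (hL : ∀ g, L g = I g • (1 : 𝓕) + N g)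
    (hI : ∀ g, I (L g) = I g) (hI1 : I 1 = 1) (hN1 : N 1 = 0)
    {r C : ℝ} {q : 𝓕 → ℝ} (hr1 : r < 1) (hr0 : 0 < r) (hC : 0 < C)
    (hadd : ∀ v w, q (v + w) ≤ q v + q w) (hle : ∀ v, ‖v‖ ≤ q v) (hqC : ∀ v, q v ≤ C * ‖v‖)
    (hqN : ∀ v, q (N v) ≤ r * q v) {K : ℝ} (hK : 0 < K) :
    ∃ t₀ B : ℝ, 0 < t₀ ∧ 0 < B ∧ t₀ ≤ 1 / 2 ∧ ∀ (t p : ℝ) (φ : 𝓕), |t| ≤ t₀ → 0 ≤ p → p ≤ 1 →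
      ‖φ‖ ≤ K → I φ = p → (∀ g, ‖I (φ * g)‖ ≤ p * ‖g‖) → ∀ n : ℕ,
      ‖I ((fun u => L ((1 + (t : ℂ) • φ) * u))^[n] 1)‖ ≤ Real.exp (n * (p * (t + B * t ^ 2))) := by
  set A : ℝ := C * K * ‖(1 : 𝓕)‖ with hA
  set D : ℝ := C * K with hD
  have hA0 : 0 ≤ A := by positivity
  have hD0 : 0 < D := by positivity
  have h1r : 0 < 1 - r := by linarith
  -- The gap `B * (1 - r)` is split in two: half absorbs `A`, the error created by the constant part
  -- of `u`; the other half absorbs all terms of order `t`, thanks to the choice of `t₀`.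
  set B : ℝ := 2 * A / (1 - r) + 1 with hB
  have hB0 : 0 < B := by positivity
  have hAB : A ≤ B * (1 - r) / 2 := by
    rw [hB]; field_simp; linarith
  clear_value A D B
  refine ⟨min (1 / 2) ((1 - r) / (2 * (D + 1 + B))), B, by positivity, hB0, min_le_left _ _, ?_⟩
  intro t p φ ht hp0 hp1 hφ hIφ hbd
  have ht2 : |t| ≤ 1 / 2 := ht.trans (min_le_left _ _)
  have ht3 : |t| * (D + 1 + B) ≤ (1 - r) / 2 := by
    have := ht.trans (min_le_right _ _)
    rw [le_div_iff₀ (by positivity)] at this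
    linarith
  have hsq : t ^ 2 = |t| * |t| := by rw [← sq, sq_abs]
  have habs := abs_le.1 ht2
  have htt : |t| * |t| ≤ |t| := by nlinarith [abs_nonneg t]
  -- The cone `q (u - I u • 1) ≤ B * |t| * ‖I u‖` is invariant, and the mean is controlled inside
  -- it.
  have key : ∀ u : 𝓕, q (u - I u • 1) ≤ B * |t| * ‖I u‖ →
      q (L ((1 + (t : ℂ) • φ) * u) - I (L ((1 + (t : ℂ) • φ) * u)) • 1) ≤
        B * |t| * ‖I (L ((1 + (t : ℂ) • φ) * u))‖ ∧
      ‖I (L ((1 + (t : ℂ) • φ) * u))‖ ≤ Real.exp (p * (t + B * t ^ 2)) * ‖I u‖ := by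
    intro u hu
    set v := u - I u • (1 : 𝓕) with hv
    have huv : u = I u • (1 : 𝓕) + v := by rw [hv]; abel
    have hw : (1 + (t : ℂ) • φ) * u = u + (t : ℂ) • (φ * u) := by
      rw [add_mul, one_mul, smul_mul_assoc]
    have hIφu : I (φ * u) = I u * p + I (φ * v) := by
      conv_lhs => rw [huv]
      rw [mul_add, mul_smul_comm, mul_one, map_add, map_smul, hIφ, smul_eq_mul]
    have ha : I (L ((1 + (t : ℂ) • φ) * u)) = I u * ((1 + t * p : ℝ) : ℂ) + t * I (φ * v) := by
      rw [hI, hw, map_add, map_smul, hIφu, smul_eq_mul]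
      push_cast; ring
    have herr : ‖(t : ℂ) * I (φ * v)‖ ≤ B * t ^ 2 * p * ‖I u‖ := by
      rw [norm_mul, Complex.norm_real, Real.norm_eq_abs]
      calc |t| * ‖I (φ * v)‖ ≤ |t| * (p * (B * |t| * ‖I u‖)) := by
            gcongr
            exact (hbd v).trans (mul_le_mul_of_nonneg_left ((hle v).trans hu) hp0)
        _ = _ := by rw [hsq]; ring
    have hpt : 0 ≤ 1 + t * p := by nlinarith
    have hmain : ‖I u * ((1 + t * p : ℝ) : ℂ)‖ = ‖I u‖ * (1 + t * p) := by
      rw [norm_mul, Complex.norm_real, Real.norm_of_nonneg hpt]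
    constructor
    · have hlow : ‖I u‖ * (1 - |t| - B * t ^ 2) ≤ ‖I (L ((1 + (t : ℂ) • φ) * u))‖ := by
        have h1 := norm_sub_le_norm_add (I u * ((1 + t * p : ℝ) : ℂ)) (t * I (φ * v))
        rw [← ha, hmain] at h1
        have h2 : 1 - |t| ≤ 1 + t * p := by nlinarith [neg_abs_le t, abs_nonneg t]
        have h3 : B * t ^ 2 * p * ‖I u‖ ≤ B * t ^ 2 * 1 * ‖I u‖ := by gcongr
        linarith [mul_le_mul_of_nonneg_left h2 (norm_nonneg (I u))]
      have hv' : L ((1 + (t : ℂ) • φ) * u) - I (L ((1 + (t : ℂ) • φ) * u)) • 1 =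
          N (v + (t : ℂ) • (φ * u)) := by
        have : N v = N u := by rw [hv, map_sub, map_smul, hN1, smul_zero, sub_zero]
        rw [hI, hL, hw, add_sub_cancel_left, map_add, map_add, this]
      rw [hv']
      have hnu : ‖u‖ ≤ ‖I u‖ * ‖(1 : 𝓕)‖ + B * |t| * ‖I u‖ := by
        conv_lhs => rw [huv]
        exact (norm_add_le _ _).trans (add_le_add (norm_smul_le _ _) ((hle v).trans hu))
      have hq1 : q ((t : ℂ) • (φ * u)) ≤ |t| * (A + D * B * |t|) * ‖I u‖ := by
        calc q ((t : ℂ) • (φ * u)) ≤ C * (|t| * (K * (‖I u‖ * ‖(1 : 𝓕)‖ + B * |t| * ‖I u‖))) := by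
              refine (hqC _).trans ?_
              rw [norm_smul, Complex.norm_real, Real.norm_eq_abs]
              gcongr
              exact (norm_mul_le _ _).trans (by gcongr)
          _ = _ := by rw [hA, hD]; ring
      have hq2 : q (v + (t : ℂ) • (φ * u)) ≤
          (B * |t| + |t| * (A + D * B * |t|)) * ‖I u‖ := by
        rw [add_mul]; exact (hadd _ _).trans (add_le_add hu hq1)
      have hX : 0 ≤ |t| * (A + D * B * |t|) * ‖I u‖ := by positivity
      have hcoef : r * B + A + D * B * |t| ≤ B * (1 - |t| - B * t ^ 2) := by
        have h4 : B * (|t| * (D + 1 + B)) ≤ B * ((1 - r) / 2) := by gcongr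
        have h5 : B * (B * t ^ 2) ≤ B * (B * |t|) := by rw [hsq]; gcongr
        linarith
      calc q (N (v + (t : ℂ) • (φ * u))) ≤
            r * ((B * |t| + |t| * (A + D * B * |t|)) * ‖I u‖) :=
              (hqN _).trans (mul_le_mul_of_nonneg_left hq2 hr0.le)
        _ ≤ (r * B + A + D * B * |t|) * (|t| * ‖I u‖) := by
              linarith [mul_le_mul_of_nonneg_right hr1.le hX]
        _ ≤ (B * (1 - |t| - B * t ^ 2)) * (|t| * ‖I u‖) := by gcongr
        _ = B * |t| * (‖I u‖ * (1 - |t| - B * t ^ 2)) := by ring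
        _ ≤ _ := by gcongr
    · rw [ha]
      refine (norm_add_le _ _).trans ?_
      rw [hmain]
      have := Real.add_one_le_exp (p * (t + B * t ^ 2))
      linarith [mul_le_mul_of_nonneg_right this (norm_nonneg (I u))]
  have all : ∀ n : ℕ,
      q ((fun u => L ((1 + (t : ℂ) • φ) * u))^[n] 1 -
        I ((fun u => L ((1 + (t : ℂ) • φ) * u))^[n] 1) • 1) ≤
        B * |t| * ‖I ((fun u => L ((1 + (t : ℂ) • φ) * u))^[n] 1)‖ ∧
      ‖I ((fun u => L ((1 + (t : ℂ) • φ) * u))^[n] 1)‖ ≤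
        Real.exp (n * (p * (t + B * t ^ 2))) := by
    intro n
    induction n with
    | zero =>
      simp only [Function.iterate_zero, id, hI1, one_smul, sub_self, norm_one, mul_one,
        Nat.cast_zero, zero_mul, Real.exp_zero, le_refl, and_true]
      refine (hqC 0).trans ?_
      rw [norm_zero, mul_zero]
      positivity
    | succ n ih =>
      simp only [Function.iterate_succ_apply']
      obtain ⟨h1, h2⟩ := key _ ih.1
      refine ⟨h1, h2.trans ?_⟩
      calc _ ≤ Real.exp (p * (t + B * t ^ 2)) * Real.exp (n * (p * (t + B * t ^ 2))) := by
            gcongr; exact ih.2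
        _ = _ := by rw [← Real.exp_add]; push_cast; ring_nf
  exact fun n => (all n).2

/-! ### Normal form of the transfer operator -/

section TransferOperator

variable {Ω : Type*} [MeasurableSpace Ω] {μ : Measure Ω} [IsProbabilityMeasure μ]
  {T : Ω → Ω} {𝓕 : Type*} [NormedCommRing 𝓕] [NormedAlgebra ℂ 𝓕] [CompleteSpace 𝓕]
  {ι : 𝓕 →ₗ[ℂ] (Ω →ₘ[μ] ℂ)}

theorem PropertyC.memLp_top (h : PropertyC μ T ι) (φ : 𝓕) : MemLp (ι φ) ∞ μ :=
  ⟨(ι φ).aestronglyMeasurable, (h.essSup_le_norm φ).trans_lt enorm_lt_top⟩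

theorem PropertyC.integrable (h : PropertyC μ T ι) (φ : 𝓕) : Integrable (ι φ) μ :=
  (h.memLp_top φ).integrable le_top

theorem PropertyC.ae_norm_le (h : PropertyC μ T ι) (φ : 𝓕) : ∀ᵐ ω ∂μ, ‖ι φ ω‖ ≤ ‖φ‖ := by
  have h1 := h.essSup_le_norm φ
  rw [eLpNorm_exponent_top] at h1
  filter_upwards [ae_le_eLpNormEssSup (f := ι φ) (μ := μ)] with ω hω
  have := hω.trans h1
  rwa [← ofReal_norm, ← ofReal_norm, ENNReal.ofReal_le_ofReal_iff (norm_nonneg _)] at this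

/-- The integral of the elements of a function algebra, as a linear functional. -/
noncomputable def PropertyC.mean (h : PropertyC μ T ι) : 𝓕 →ₗ[ℂ] ℂ where
  toFun φ := ∫ ω, ι φ ω ∂μ
  map_add' φ ψ := by
    rw [map_add, integral_congr_ae (AEEqFun.coeFn_add (ι φ) (ι ψ))]
    exact integral_add (h.integrable φ) (h.integrable ψ)
  map_smul' c φ := by
    rw [map_smul, integral_congr_ae (AEEqFun.coeFn_smul c (ι φ))]
    exact integral_const_mul c _

theorem PropertyC.mean_apply (h : PropertyC μ T ι) (φ : 𝓕) : h.mean φ = ∫ ω, ι φ ω ∂μ := rfl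

theorem PropertyC.mean_one (h : PropertyC μ T ι) : h.mean 1 = 1 := by
  rw [h.mean_apply, h.functionAlgebra.map_one, integral_congr_ae AEEqFun.coeFn_one]
  simp

theorem PropertyC.norm_mean_le (h : PropertyC μ T ι) (φ : 𝓕) : ‖h.mean φ‖ ≤ ‖φ‖ := by
  simpa [h.mean_apply] using norm_integral_le_of_norm_le_const (h.ae_norm_le φ)

theorem PropertyC.mean_transfer (h : PropertyC μ T ι) {L : 𝓕 →L[ℂ] 𝓕}
    (hL : ∀ φ : 𝓕, IsTransferOf μ T (ι φ) (ι (L φ))) (φ : 𝓕) : h.mean (L φ) = h.mean φ := by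
  have := (hL φ).2.2 (fun _ => 1) (memLp_top_const 1)
  simpa [h.mean_apply] using this

theorem PropertyC.transfer_one (h : PropertyC μ T ι) {L : 𝓕 →L[ℂ] 𝓕}
    (hL : ∀ φ : 𝓕, IsTransferOf μ T (ι φ) (ι (L φ))) : L 1 = 1 := by
  apply h.functionAlgebra.injective
  apply AEEqFun.ext
  refine (hL 1).ae_eq ⟨h.integrable 1, h.integrable 1, fun g hg => ?_⟩
  have e : ι 1 =ᵐ[μ] (1 : Ω → ℂ) := by
    rw [h.functionAlgebra.map_one]; exact AEEqFun.coeFn_one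
  have e1 : (fun ω => ι 1 ω * g ω) =ᵐ[μ] g := by
    filter_upwards [e] with ω hω; simp [hω]
  have e2 : (fun ω => ι 1 ω * g (T ω)) =ᵐ[μ] fun ω => g (T ω) := by
    filter_upwards [e] with ω hω; simp [hω]
  have hT := h.isMixing.invariant
  rw [integral_congr_ae e1, integral_congr_ae e2]
  conv_lhs => rw [← hT.map_eq]
  rw [integral_map hT.aemeasurable]
  rw [hT.map_eq]; exact hg.1

/-- Eigenvalues of the transfer operator have modulus at most one. -/
theorem PropertyC.norm_eigenvalue_le_one (h : PropertyC μ T ι) {L : 𝓕 →L[ℂ] 𝓕}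
    (hL : ∀ φ : 𝓕, IsTransferOf μ T (ι φ) (ι (L φ))) {c : ℂ} {e : 𝓕} (he : e ≠ 0)
    (hc : L e = c • e) : ‖c‖ ≤ 1 := by
  set u : Ω → ℂ := ⇑(ι e) with hu
  have hT := h.isMixing.invariant
  have hmem : MemLp u 2 μ := (h.memLp_top e).mono_exponent le_top
  have hsq : Integrable (fun ω => ‖u ω‖ ^ 2) μ := hmem.integrable_norm_pow (by norm_num)
  have hsqT : Integrable (fun ω => ‖u (T ω)‖ ^ 2) μ := hT.integrable_comp_of_integrable hsq
  have hint : ∫ ω, ‖u (T ω)‖ ^ 2 ∂μ = ∫ ω, ‖u ω‖ ^ 2 ∂μ := by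
    conv_rhs => rw [← hT.map_eq]
    rw [integral_map hT.aemeasurable]
    rw [hT.map_eq]; exact hsq.1
  have hpos : 0 < ∫ ω, ‖u ω‖ ^ 2 ∂μ := by
    refine lt_of_le_of_ne (integral_nonneg fun ω => by positivity) fun h0 => he ?_
    rw [eq_comm, integral_eq_zero_iff_of_nonneg (fun ω => by positivity) hsq] at h0
    apply h.functionAlgebra.injective
    rw [map_zero]
    apply AEEqFun.ext
    filter_upwards [h0, AEEqFun.coeFn_zero (α := Ω) (β := ℂ) (μ := μ)] with ω h1 h2
    rw [h2]
    simpa using h1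
  have hid := (hL e).2.2 (fun ω => star (u ω)) (h.memLp_top e).star
  have hl : ∫ ω, ι (L e) ω * star (u ω) ∂μ = c * ((∫ ω, ‖u ω‖ ^ 2 ∂μ : ℝ) : ℂ) := by
    rw [← integral_complex_ofReal, ← integral_const_mul]
    refine integral_congr_ae ?_
    rw [hc, map_smul]
    filter_upwards [AEEqFun.coeFn_smul c (ι e)] with ω hω
    rw [hω, Pi.smul_apply, smul_eq_mul, mul_assoc]
    simp [hu, Complex.mul_conj']
  -- Cauchy–Schwarz in `L²`, through `ab ≤ (a² + b²) / 2` and the invariance of `μ`.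
  have hr : ‖∫ ω, ι e ω * star (u (T ω)) ∂μ‖ ≤ ∫ ω, ‖u ω‖ ^ 2 ∂μ := by
    calc ‖∫ ω, ι e ω * star (u (T ω)) ∂μ‖ ≤ ∫ ω, (‖u ω‖ ^ 2 + ‖u (T ω)‖ ^ 2) / 2 ∂μ := by
          refine norm_integral_le_of_norm_le ((hsq.add hsqT).div_const 2) (ae_of_all _ fun ω => ?_)
          rw [norm_mul, norm_star, ← hu]
          nlinarith [sq_nonneg (‖u ω‖ - ‖u (T ω)‖)]
      _ = ∫ ω, ‖u ω‖ ^ 2 ∂μ := by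
          rw [integral_div, integral_add hsq hsqT, hint]; ring
  rw [← hid, hl, norm_mul, Complex.norm_real, Real.norm_of_nonneg hpos.le] at hr
  exact le_of_mul_le_mul_right (by linarith) hpos

/-- The spectral gap of the transfer operator in normal form: the dominant part is `g ↦ ∫ g`. -/
theorem PropertyC.exists_transfer_decomposition (h : PropertyC μ T ι) :
    ∃ L N : 𝓕 →L[ℂ] 𝓕, (∀ φ : 𝓕, IsTransferOf μ T (ι φ) (ι (L φ))) ∧
      (∀ g, L g = h.mean g • (1 : 𝓕) + N g) ∧ N 1 = 0 ∧ spectralRadius ℂ N < 1 := by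
  obtain ⟨L, hL, c, P, N, hU, hP, hrank, hrad, hPN, hNP⟩ := h.transfer
  have one_ne : (1 : 𝓕) ≠ 0 := fun h0 => by
    have := h.mean_one
    rw [h0, map_zero] at this
    exact zero_ne_one this
  have P_P : ∀ g, P (P g) = P g := fun g => congrArg (· g) hP
  have P_N : ∀ g, P (N g) = 0 := fun g => congrArg (· g) hPN
  have N_P : ∀ g, N (P g) = 0 := fun g => congrArg (· g) hNP
  have L_apply : ∀ g, L g = c • P g + N g := fun g => congrArg (· g) hU
  obtain ⟨⟨e', g, rfl⟩, he0, hspan⟩ := finrank_eq_one_iff'.1 hrank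
  have he0' : P g ≠ 0 := fun h0 => he0 (Subtype.ext h0)
  have hc1 : ‖c‖ ≤ 1 := h.norm_eigenvalue_le_one hL he0' (by
    rw [L_apply, P_P, N_P, add_zero])
  have hN1 : spectralRadius ℂ N < 1 := hrad.trans_le (by
    rw [← ofReal_norm]; exact ENNReal.ofReal_le_one.2 hc1)
  obtain ⟨r, C, q, hr0, hr1, hC, -, hle, hqC, hqN⟩ := exists_adapted_norm N hN1
  have hlim : ∀ v, Tendsto (fun n : ℕ => N^[n] v) atTop (𝓝 0) := by
    intro v
    have hq : ∀ n : ℕ, q (N^[n] v) ≤ r ^ n * q v := by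
      intro n
      induction n with
      | zero => simp
      | succ n ih =>
        rw [Function.iterate_succ_apply']
        refine (hqN _).trans ?_
        rw [pow_succ', mul_assoc]
        gcongr
    refine squeeze_zero_norm (fun n => (hle _).trans (hq n)) ?_
    simpa using (tendsto_pow_atTop_nhds_zero_of_lt_one hr0.le hr1).mul_const (q v)
  have L1 : L 1 = 1 := h.transfer_one hL
  have PL : P 1 = c • P 1 := by
    have := congrArg P (L_apply 1)
    rwa [L1, map_add, map_smul, P_P, P_N, add_zero] at this
  -- `1 - P 1` is fixed by `N`, whose iterates tend to zero.
  have hP1 : P 1 = 1 := by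
    have hfix : N (1 - P 1) = 1 - P 1 := by
      have := L_apply 1
      rw [L1, ← PL] at this
      rw [map_sub, N_P, sub_zero, eq_sub_iff_add_eq, add_comm]
      exact this.symm
    have hit : ∀ n : ℕ, N^[n] (1 - P 1) = 1 - P 1 := fun n => Function.iterate_fixed hfix n
    have := hlim (1 - P 1)
    simp only [hit] at this
    exact (sub_eq_zero.1 (tendsto_nhds_unique tendsto_const_nhds this)).symm
  have hc : c = 1 := by
    rw [hP1] at PL
    have : (c - 1) • (1 : 𝓕) = 0 := by rw [sub_smul, one_smul, ← PL, sub_self]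
    exact sub_eq_zero.1 ((smul_eq_zero.1 this).resolve_right one_ne)
  subst hc
  have hN_one : N 1 = 0 := by rw [← hP1]; exact N_P 1
  have hspan' : ∀ g', ∃ a : ℂ, P g' = a • (1 : 𝓕) := by
    obtain ⟨b, hb⟩ := hspan ⟨P 1, 1, rfl⟩
    have hb' : b • P g = 1 := (congrArg Subtype.val hb).trans hP1
    have hb0 : b ≠ 0 := by rintro rfl; rw [zero_smul] at hb'; exact one_ne hb'.symm
    intro g'
    obtain ⟨a, ha⟩ := hspan ⟨P g', g', rfl⟩
    refine ⟨a * b⁻¹, ?_⟩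
    rw [← hb', smul_smul, inv_mul_cancel_right₀ hb0]
    exact (congrArg Subtype.val ha).symm
  -- On the kernel of `P` the operators `L` and `N` agree, so the mean is constant along `N^[n] v →
  -- 0`.
  have mean_N : ∀ v, P v = 0 → h.mean v = 0 := by
    intro v hv
    have hcst : ∀ n : ℕ, P (N^[n] v) = 0 ∧ h.mean (N^[n] v) = h.mean v := by
      intro n
      induction n with
      | zero => exact ⟨hv, rfl⟩
      | succ n ih =>
        rw [Function.iterate_succ_apply']
        refine ⟨P_N _, ?_⟩
        rw [← ih.2, ← h.mean_transfer hL (N^[n] v), L_apply, ih.1, smul_zero, zero_add]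
    have h0 : Tendsto (fun n : ℕ => h.mean (N^[n] v)) atTop (𝓝 0) :=
      squeeze_zero_norm (fun n => h.norm_mean_le _) (by simpa using (hlim v).norm)
    simp only [(hcst _).2] at h0
    exact tendsto_nhds_unique tendsto_const_nhds h0
  refine ⟨L, N, hL, fun g' => ?_, hN_one, hN1⟩
  obtain ⟨a, ha⟩ := hspan' g'
  have := mean_N (g' - P g') (by rw [map_sub, P_P, sub_self])
  rw [map_sub, ha, map_smul, h.mean_one, sub_eq_zero, smul_eq_mul, mul_one] at this
  rw [L_apply, one_smul, ha, this]

/-! ### Exponential moments and deviations -/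

theorem PropertyC.coeFn_mul (h : PropertyC μ T ι) (φ ψ : 𝓕) :
    ι (φ * ψ) =ᵐ[μ] fun ω => ι φ ω * ι ψ ω := by
  rw [h.functionAlgebra.map_mul]
  exact AEEqFun.coeFn_mul _ _

/-- Duality moves one `L` at a time onto the test function. `g` stays universally quantified because
the induction replaces it by `v * g ∘ T`. -/
theorem PropertyC.integral_iterate_transfer_mul (h : PropertyC μ T ι) {L : 𝓕 →L[ℂ] 𝓕}
    (hL : ∀ φ : 𝓕, IsTransferOf μ T (ι φ) (ι (L φ))) {ψ : 𝓕} {v : Ω → ℂ} (hv : ι ψ =ᵐ[μ] v)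
    (n : ℕ) : ∀ g : Ω → ℂ, MemLp g ∞ μ →
      ∫ ω, ι ((fun u => L (ψ * u))^[n] 1) ω * g ω ∂μ =
        ∫ ω, (∏ k ∈ Finset.range n, v (T^[k] ω)) * g (T^[n] ω) ∂μ := by
  induction n with
  | zero =>
    intro g _
    refine integral_congr_ae ?_
    simp only [Function.iterate_zero, id, Finset.range_zero, Finset.prod_empty,
      h.functionAlgebra.map_one]
    filter_upwards [AEEqFun.coeFn_one (α := Ω) (β := ℂ) (μ := μ)] with ω hω
    rw [hω, Pi.one_apply]
  | succ n ih =>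
    intro g hg
    have hgT : MemLp (fun ω => g (T ω)) ∞ μ := hg.comp_measurePreserving h.isMixing.invariant
    have hv' : MemLp v ∞ μ := (memLp_congr_ae hv).1 (h.memLp_top ψ)
    rw [Function.iterate_succ_apply', (hL _).2.2 g hg]
    have e : (fun ω => ι (ψ * (fun u => L (ψ * u))^[n] 1) ω * g (T ω)) =ᵐ[μ]
        fun ω => ι ((fun u => L (ψ * u))^[n] 1) ω * (v ω * g (T ω)) := by
      filter_upwards [hv, h.coeFn_mul ψ ((fun u => L (ψ * u))^[n] 1)] with ω h1 h2
      rw [h2, h1]; ring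
    rw [integral_congr_ae e, ih (fun ω => v ω * g (T ω)) (hgT.mul hv')]
    refine integral_congr_ae (ae_of_all _ fun ω => ?_)
    simp only [Finset.prod_range_succ, Function.iterate_succ_apply']
    ring

/-- Allows the product of the factors `1 + t * w` to dominate an exponential, at the cost of a
second order loss in `t`. -/
theorem Real.exp_sub_sq_mul_le {t x : ℝ} (ht : |t| ≤ 1 / 2) (hx0 : 0 ≤ x) (hx1 : x ≤ 1) :
    Real.exp ((t - t ^ 2) * x) ≤ 1 + t * x := by
  have habs := abs_le.1 ht
  have hy : -(1 / 2) ≤ t * x := by nlinarith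
  have hy' : t * x ≤ 1 / 2 := by nlinarith
  have hx2 : t ^ 2 * x ^ 2 ≤ t ^ 2 * x := by
    refine mul_le_mul_of_nonneg_left ?_ (sq_nonneg t)
    nlinarith
  have h1 : Real.exp ((t - t ^ 2) * x) ≤ Real.exp (t * x - (t * x) ^ 2) :=
    Real.exp_le_exp.2 (by rw [mul_pow]; linarith)
  refine h1.trans ?_
  set y := t * x
  -- For `y ≥ 0` the tangent line suffices, as `(1 + y) * (1 - y + y ^ 2) = 1 + y ^ 3`; for `y ≤ 0`
  -- the quadratic Taylor term is needed.
  have h2 : 1 ≤ (1 + y) * Real.exp (y ^ 2 - y) := by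
    rcases le_total y 0 with h | h
    · have h3 := Real.quadratic_le_exp_of_nonneg (show 0 ≤ y ^ 2 - y by nlinarith)
      have h4 : 0 ≤ y ^ 2 * ((1 - y) * (1 - y ^ 2) / 2 + y) :=
        mul_nonneg (sq_nonneg y) (by nlinarith)
      calc 1 ≤ (1 + y) * (1 + (y ^ 2 - y) + (y ^ 2 - y) ^ 2 / 2) := by linarith
        _ ≤ _ := mul_le_mul_of_nonneg_left h3 (by linarith)
    · have h3 := Real.add_one_le_exp (y ^ 2 - y)
      calc 1 ≤ (1 + y) * (y ^ 2 - y + 1) := by linarith [pow_nonneg h 3]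
        _ ≤ _ := mul_le_mul_of_nonneg_left h3 (by linarith)
  rw [← neg_sub, Real.exp_neg, inv_eq_one_div]
  exact (div_le_iff₀ (Real.exp_pos _)).2 h2

theorem PropertyC.exists_integral_exp_le (h : PropertyC μ T ι) {K : ℝ} (hK : 0 < K) :
    ∃ t₀ B : ℝ, 0 < t₀ ∧ 0 < B ∧ t₀ ≤ 1 / 2 ∧ ∀ (t : ℝ) (φ : 𝓕) (w : Ω → ℝ), |t| ≤ t₀ →
      Measurable w → (∀ ω, 0 ≤ w ω) → (∀ ω, w ω ≤ 1) → ι φ =ᵐ[μ] (fun ω => (w ω : ℂ)) →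
      ‖φ‖ ≤ K → ∀ n : ℕ, ∫ ω, Real.exp ((t - t ^ 2) * birkhoffSum T w n ω) ∂μ ≤
        Real.exp (n * ((∫ ω, w ω ∂μ) * (t + B * t ^ 2))) := by
  obtain ⟨L, N, hL, hLN, hN1, hrad⟩ := h.exists_transfer_decomposition
  obtain ⟨r, C, q, hr0, hr1, hC, hadd, hle, hqC, hqN⟩ := exists_adapted_norm N hrad
  obtain ⟨t₀, B, ht₀, hB, ht₀', key⟩ := exists_norm_iterate_le L N h.mean hLN
    (h.mean_transfer hL) h.mean_one hN1 hr1 hr0 hC hadd hle hqC hqN hK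
  refine ⟨t₀, B, ht₀, hB, ht₀', fun t φ w ht hw hw0 hw1 hφ hφK n => ?_⟩
  have hT := h.isMixing.invariant
  have hwint : Integrable w μ :=
    .of_bound hw.aestronglyMeasurable 1 (ae_of_all _ fun ω => by
      rw [Real.norm_of_nonneg (hw0 ω)]; exact hw1 ω)
  have hp0 : 0 ≤ ∫ ω, w ω ∂μ := integral_nonneg hw0
  have hp1 : ∫ ω, w ω ∂μ ≤ 1 := by
    simpa using integral_mono hwint (integrable_const (1 : ℝ)) hw1
  have hmean : h.mean φ = ((∫ ω, w ω ∂μ : ℝ) : ℂ) := by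
    rw [h.mean_apply, integral_congr_ae hφ, integral_complex_ofReal]
  -- Positivity of `w` and the sup bound for `g` yield the factor `∫ w` instead of `‖φ‖`.
  have hbd : ∀ g, ‖h.mean (φ * g)‖ ≤ (∫ ω, w ω ∂μ) * ‖g‖ := by
    intro g
    rw [h.mean_apply, ← integral_mul_const]
    refine norm_integral_le_of_norm_le (hwint.mul_const _) ?_
    filter_upwards [hφ, h.coeFn_mul φ g, h.ae_norm_le g] with ω h1 h2 h3
    rw [h2, h1, norm_mul, Complex.norm_real, Real.norm_of_nonneg (hw0 ω)]
    exact mul_le_mul_of_nonneg_left h3 (hw0 ω)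
  have hψ : ι (1 + (t : ℂ) • φ) =ᵐ[μ] fun ω => ((1 + t * w ω : ℝ) : ℂ) := by
    rw [map_add, map_smul, h.functionAlgebra.map_one]
    filter_upwards [AEEqFun.coeFn_add (1 : Ω →ₘ[μ] ℂ) ((t : ℂ) • ι φ),
      AEEqFun.coeFn_one (α := Ω) (β := ℂ) (μ := μ), AEEqFun.coeFn_smul (t : ℂ) (ι φ), hφ]
      with ω h1 h2 h3 h4
    rw [h1, Pi.add_apply, h2, h3, Pi.smul_apply, h4]
    simp
  have hprod := h.integral_iterate_transfer_mul hL hψ n (fun _ => 1) (memLp_top_const 1)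
  have hbound := key t _ φ ht hp0 hp1 hφK hmean hbd n
  simp only [mul_one] at hprod
  rw [h.mean_apply, hprod] at hbound
  simp only [← Complex.ofReal_prod] at hbound
  rw [integral_complex_ofReal, Complex.norm_real] at hbound
  refine le_trans ?_ ((Real.le_norm_self _).trans hbound)
  have ht2 : |t| ≤ 1 / 2 := ht.trans ht₀'
  have hpos : ∀ ω, 0 ≤ 1 + t * w ω := fun ω =>
    (Real.exp_pos _).le.trans (Real.exp_sub_sq_mul_le ht2 (hw0 ω) (hw1 ω))
  have hle2 : ∀ ω, 1 + t * w ω ≤ 2 := fun ω => by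
    nlinarith [(abs_le.1 ht2).2, hw0 ω, hw1 ω]
  have hTm : ∀ k, Measurable (T^[k]) := fun k => hT.measurable.iterate k
  refine integral_mono_of_nonneg (ae_of_all _ fun ω => (Real.exp_pos _).le) ?_
    (ae_of_all _ fun ω => ?_)
  · refine .of_bound (C := 2 ^ n) (Finset.measurable_prod _ fun k _ =>
      ((hw.comp (hTm k)).const_mul t).const_add 1).aestronglyMeasurable (ae_of_all _ fun ω => ?_)
    rw [Real.norm_of_nonneg (Finset.prod_nonneg fun k _ => hpos _)]
    calc _ ≤ ∏ k ∈ Finset.range n, (2 : ℝ) :=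
          Finset.prod_le_prod (fun k _ => hpos _) fun k _ => hle2 _
      _ = _ := by simp
  · simp only [birkhoffSum, Finset.mul_sum, Real.exp_sum]
    exact Finset.prod_le_prod (fun k _ => (Real.exp_pos _).le) fun k _ =>
      Real.exp_sub_sq_mul_le ht2 (hw0 _) (hw1 _)

/-- Exponential deviation inequality for Birkhoff sums of `[0, 1]`-valued observables, uniform over
bounded sets of `𝓕`, with the exponent proportional to the mean of the sum. -/
theorem PropertyC.exists_measure_deviation_le (h : PropertyC μ T ι) {K : ℝ} (hK : 0 < K)
    {ε : ℝ} (hε : 0 < ε) (hε1 : ε < 1) :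
    ∃ c : ℝ, 0 < c ∧ ∀ (φ : 𝓕) (w : Ω → ℝ), Measurable w → (∀ ω, 0 ≤ w ω) → (∀ ω, w ω ≤ 1) →
      ι φ =ᵐ[μ] (fun ω => (w ω : ℂ)) → ‖φ‖ ≤ K → ∀ n : ℕ,
      μ.real {ω | ε * (n * ∫ ω', w ω' ∂μ) ≤ |birkhoffSum T w n ω - n * ∫ ω', w ω' ∂μ|} ≤
        2 * Real.exp (-c * (n * ∫ ω', w ω' ∂μ)) := by
  obtain ⟨t₀, B, ht₀, hB, ht₀', key⟩ := h.exists_integral_exp_le hK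
  -- Both tails have exponent at most `-ε * t + (B + 2) * t ^ 2` times the mean; this `t` makes it
  -- at most `-ε * t / 2`.
  set t := min t₀ (ε / (2 * (B + 2))) with htdef
  have ht0 : 0 < t := by positivity
  have htB : (B + 2) * t ≤ ε / 2 := by
    have : t ≤ ε / (2 * (B + 2)) := min_le_right _ _
    rw [le_div_iff₀ (by positivity)] at this
    linarith
  have htt₀ : t ≤ t₀ := min_le_left _ _
  have ht12 : t ≤ 1 / 2 := htt₀.trans ht₀'
  clear_value t
  refine ⟨ε * t / 2, by positivity, fun φ w hw hw0 hw1 hφ hφK n => ?_⟩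
  have hTm : ∀ k, Measurable (T^[k]) := fun k => h.isMixing.invariant.measurable.iterate k
  set S := birkhoffSum T w n with hS
  set p := ∫ ω', w ω' ∂μ with hp
  have hp0 : 0 ≤ p := integral_nonneg hw0
  set E := (n : ℝ) * p with hE
  have hE0 : 0 ≤ E := by positivity
  have hSm : Measurable S := Finset.measurable_sum _ fun k _ => hw.comp (hTm k)
  have hS0 : ∀ ω, 0 ≤ S ω := fun ω => Finset.sum_nonneg fun k _ => hw0 _
  have hSn : ∀ ω, S ω ≤ n := fun ω => by
    calc S ω ≤ ∑ k ∈ Finset.range n, (1 : ℝ) := Finset.sum_le_sum fun k _ => hw1 _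
      _ = n := by simp
  have hint : ∀ s : ℝ, Integrable (fun ω => Real.exp (s * S ω)) μ := fun s => by
    refine .of_bound (C := Real.exp (|s| * n)) (by fun_prop) (ae_of_all _ fun ω => ?_)
    rw [Real.norm_of_nonneg (Real.exp_pos _).le]
    refine Real.exp_le_exp.2 ((le_abs_self _).trans ?_)
    rw [abs_mul, abs_of_nonneg (hS0 ω)]
    exact mul_le_mul_of_nonneg_left (hSn ω) (abs_nonneg s)
  have up : μ.real {ω | (1 + ε) * E ≤ S ω} ≤ Real.exp (-(ε * t / 2) * E) := by
    have hk := key t φ w (by rwa [abs_of_pos ht0]) hw hw0 hw1 hφ hφK n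
    refine (ProbabilityTheory.measure_ge_le_exp_mul_mgf (t := t - t ^ 2) _ (by nlinarith)
      (hint _)).trans ?_
    refine (mul_le_mul_of_nonneg_left hk (Real.exp_pos _).le).trans ?_
    rw [← Real.exp_add, ← mul_assoc]
    refine Real.exp_le_exp.2 ?_
    have : -(t - t ^ 2) * (1 + ε) + (t + B * t ^ 2) ≤ -(ε * t / 2) := by
      nlinarith [mul_le_mul_of_nonneg_right htB ht0.le, sq_nonneg t]
    have := mul_le_mul_of_nonneg_right this hE0
    linarith
  have down : μ.real {ω | S ω ≤ (1 - ε) * E} ≤ Real.exp (-(ε * t / 2) * E) := by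
    have hk := key (-t) φ w (by rwa [abs_neg, abs_of_pos ht0]) hw hw0 hw1 hφ hφK n
    refine (ProbabilityTheory.measure_le_le_exp_mul_mgf (t := -t - (-t) ^ 2) _ (by nlinarith)
      (hint _)).trans ?_
    refine (mul_le_mul_of_nonneg_left hk (Real.exp_pos _).le).trans ?_
    rw [← Real.exp_add, ← mul_assoc]
    refine Real.exp_le_exp.2 ?_
    have : -(-t - (-t) ^ 2) * (1 - ε) + (-t + B * (-t) ^ 2) ≤ -(ε * t / 2) := by
      nlinarith [mul_le_mul_of_nonneg_right htB ht0.le, sq_nonneg t]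
    have := mul_le_mul_of_nonneg_right this hE0
    linarith
  have hsub : {ω | ε * E ≤ |S ω - E|} ⊆ {ω | (1 + ε) * E ≤ S ω} ∪ {ω | S ω ≤ (1 - ε) * E} := by
    intro ω hω
    rcases le_abs.1 (show ε * E ≤ |S ω - E| from hω) with h1 | h1
    · left; show (1 + ε) * E ≤ S ω; linarith
    · right; show S ω ≤ (1 - ε) * E; linarith
  calc _ ≤ _ := measureReal_mono hsub
    _ ≤ _ := measureReal_union_le _ _
    _ ≤ _ := by linarith

/-! ### Truncated sums and almost sure convergence -/

variable {χ : Ω → ℝ}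

theorem PropertyD.measurable_trunc (h : PropertyD μ T ι χ) (ℓ : ℝ) : Measurable (trunc χ ℓ) :=
  h.measurable.indicator (measurableSet_le h.measurable measurable_const)

theorem PropertyD.trunc_nonneg (h : PropertyD μ T ι χ) (ℓ : ℝ) (ω : Ω) : 0 ≤ trunc χ ℓ ω :=
  Set.indicator_nonneg (fun _ _ => h.nonneg _) ω

theorem trunc_le {Ω : Type*} {χ : Ω → ℝ} {ℓ : ℝ} (hℓ : 0 ≤ ℓ) (ω : Ω) : trunc χ ℓ ω ≤ ℓ :=
  Set.indicator_le' (fun _ h => h) (fun _ _ => hℓ) ω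

theorem PropertyD.integral_truncSum (h : PropertyD μ T ι χ) {ℓ : ℝ} (hℓ : 0 ≤ ℓ) (n : ℕ) :
    ∫ ω, truncSum T χ ℓ n ω ∂μ = n * ∫ ω, trunc χ ℓ ω ∂μ := by
  have hint : Integrable (trunc χ ℓ) μ :=
    .of_bound (h.measurable_trunc ℓ).aestronglyMeasurable ℓ (ae_of_all _ fun ω => by
      rw [Real.norm_of_nonneg (h.trunc_nonneg ℓ ω)]; exact trunc_le hℓ ω)
  have hT : ∀ k, MeasurePreserving (T^[k]) μ μ := fun k =>
    h.propertyC.isMixing.invariant.iterate k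
  simp only [truncSum, birkhoffSum]
  rw [integral_finsetSum (f := fun k ω => trunc χ ℓ (T^[k] ω)) _
    fun k _ => (hT k).integrable_comp_of_integrable hint]
  have e : ∀ k, ∫ ω, trunc χ ℓ (T^[k] ω) ∂μ = ∫ ω, trunc χ ℓ ω ∂μ := fun k => by
    conv_rhs => rw [← (hT k).map_eq]
    rw [integral_map (hT k).aemeasurable]
    rw [(hT k).map_eq]; exact hint.1
  simp [e]

/-- Dividing by `ℓ` gives a `[0, 1]`-valued observable of norm at most `K₁`, whence `c` does not
depend on `ℓ`. -/
theorem PropertyD.exists_measure_truncSum_deviation_le (h : PropertyD μ T ι χ) {ε : ℝ}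
    (hε : 0 < ε) (hε1 : ε < 1) :
    ∃ c : ℝ, 0 < c ∧ ∀ (ℓ : ℝ) (n : ℕ), 0 < ℓ →
      μ.real {ω | ε * ∫ ω', truncSum T χ ℓ n ω' ∂μ ≤
          |truncSum T χ ℓ n ω - ∫ ω', truncSum T χ ℓ n ω' ∂μ|} ≤
        2 * Real.exp (-c * ((∫ ω', truncSum T χ ℓ n ω' ∂μ) / ℓ)) := by
  obtain ⟨K, hK, hφ⟩ := h.norm_trunc
  obtain ⟨c, hc, key⟩ := h.propertyC.exists_measure_deviation_le hK hε hε1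
  refine ⟨c, hc, fun ℓ n hℓ => ?_⟩
  obtain ⟨φ, hφ1, hφ2⟩ := hφ ℓ hℓ
  have := key ((ℓ⁻¹ : ℂ) • φ) (fun ω => ℓ⁻¹ * trunc χ ℓ ω) ((h.measurable_trunc ℓ).const_mul _)
    (fun ω => mul_nonneg (inv_nonneg.2 hℓ.le) (h.trunc_nonneg ℓ ω))
    (fun ω => by rw [inv_mul_le_iff₀ hℓ, mul_one]; exact trunc_le hℓ.le ω)
    (by
      rw [map_smul]
      filter_upwards [AEEqFun.coeFn_smul (ℓ⁻¹ : ℂ) (ι φ), hφ1] with ω h1 h2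
      rw [h1, Pi.smul_apply, h2]; simp)
    (by
      rw [norm_smul, norm_inv, Complex.norm_real, Real.norm_of_nonneg hℓ.le, inv_mul_le_iff₀ hℓ]
      linarith) n
  have hE : (n : ℝ) * ∫ ω, ℓ⁻¹ * trunc χ ℓ ω ∂μ = ℓ⁻¹ * ∫ ω, truncSum T χ ℓ n ω ∂μ := by
    rw [h.integral_truncSum hℓ.le, integral_const_mul]; ring
  have hS : ∀ ω, birkhoffSum T (fun ω => ℓ⁻¹ * trunc χ ℓ ω) n ω = ℓ⁻¹ * truncSum T χ ℓ n ω :=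
    fun ω => by simp only [birkhoffSum, truncSum, Finset.mul_sum]
  simp only [hE, hS] at this
  convert this using 3
  · funext ω
    rw [← mul_sub, abs_mul, abs_of_pos (inv_pos.2 hℓ), mul_left_comm,
      mul_le_mul_iff_right₀ (inv_pos.2 hℓ)]
  · rw [div_eq_inv_mul]

end TransferOperator

theorem theorem2p3 {Ω : Type*} [MeasurableSpace Ω] (μ : Measure Ω) [IsProbabilityMeasure μ]
    (T : Ω → Ω) {𝓕 : Type*} [NormedCommRing 𝓕] [NormedAlgebra ℂ 𝓕] [CompleteSpace 𝓕]
    (ι : 𝓕 →ₗ[ℂ] (Ω →ₘ[μ] ℂ)) (χ : Ω → ℝ) (hD : PropertyD μ T ι χ)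
    (f : ℕ → ℝ) (hf : ∀ n, 1 ≤ n → 0 < f n)
    (hF : ∀ n, 1 ≤ n → 0 < μ {ω | χ ω ≤ f n})
    (hψ : ∃ ψ : ℕ → ℝ, (∀ n, 1 ≤ n → 0 < ψ n) ∧ Summable (fun n => 1 / ψ n) ∧
      (fun n => f n) =o[atTop]
        (fun n => (∫ ω, truncSum T χ (f n) n ω ∂μ) / Real.log (ψ n))) :
    ∀ᵐ ω ∂μ, Tendsto
      (fun n => truncSum T χ (f n) n ω / ∫ ω', truncSum T χ (f n) n ω' ∂μ) atTop (𝓝 1) := by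
  obtain ⟨ψ, hψ0, hsum, ho⟩ := hψ
  set E : ℕ → ℝ := fun n => ∫ ω', truncSum T χ (f n) n ω' ∂μ with hE
  have hE0 : ∀ n, 0 ≤ E n := fun n => integral_nonneg fun ω => by
    simp only [truncSum, birkhoffSum]
    exact Finset.sum_nonneg fun k _ => hD.trunc_nonneg _ _
  have key : ∀ ε : ℝ, 0 < ε → ε < 1 →
      ∀ᵐ ω ∂μ, ∀ᶠ n in atTop, |truncSum T χ (f n) n ω - E n| < ε * E n := by
    intro ε hε hε1
    obtain ⟨c, hc, hdev⟩ := hD.exists_measure_truncSum_deviation_le hε hε1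
    -- The little-o bound with constant `c` says `log (ψ n) ≤ c * E n / f n`; the logarithm is
    -- positive since `1 / ψ n → 0`.
    have hlarge : ∀ᶠ n in atTop, 1 ≤ n ∧ Real.exp (-c * (E n / f n)) ≤ 1 / ψ n := by
      have hlt : ∀ᶠ n in atTop, 1 / ψ n < 1 :=
        hsum.tendsto_atTop_zero.eventually (gt_mem_nhds one_pos)
      filter_upwards [ho.bound hc, hlt, eventually_ge_atTop 1] with n h1 h2 h3
      refine ⟨h3, ?_⟩
      have hψn := hψ0 n h3
      have hfn := hf n h3
      have hlog : 0 < Real.log (ψ n) := Real.log_pos (by rwa [div_lt_one hψn] at h2)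
      rw [Real.norm_of_nonneg hfn.le, Real.norm_of_nonneg (div_nonneg (hE0 n) hlog.le),
        ← mul_div_assoc, le_div_iff₀ hlog] at h1
      have hinv : 1 / ψ n = Real.exp (-Real.log (ψ n)) := by
        rw [Real.exp_neg, Real.exp_log hψn, one_div]
      rw [hinv]
      refine Real.exp_le_exp.2 ?_
      rw [neg_mul, neg_le_neg_iff, ← mul_div_assoc, le_div_iff₀ hfn]
      linarith
    have hsummable : Summable fun n =>
        μ.real {ω | ε * E n ≤ |truncSum T χ (f n) n ω - E n|} := by
      refine Summable.of_norm_bounded_eventually_nat (hsum.mul_left 2) ?_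
      filter_upwards [hlarge] with n hn
      rw [Real.norm_of_nonneg measureReal_nonneg]
      exact (hdev (f n) n (hf n hn.1)).trans (mul_le_mul_of_nonneg_left hn.2 zero_le_two)
    have hfin : ∑' n, μ {ω | ε * E n ≤ |truncSum T χ (f n) n ω - E n|} ≠ ∞ := by
      have := hsummable.tsum_ofReal_ne_top
      simpa only [ofReal_measureReal (measure_ne_top μ _)] using this
    filter_upwards [ae_eventually_notMem hfin] with ω hω
    filter_upwards [hω] with n hn
    exact not_le.1 hn
  -- Countably many tolerances, so that one null set serves them all.
  have hall : ∀ᵐ ω ∂μ, ∀ j : ℕ, ∀ᶠ n in atTop,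
      |truncSum T χ (f n) n ω - E n| < 1 / ((j : ℝ) + 2) * E n :=
    ae_all_iff.2 fun j => key _ (by positivity) (by rw [div_lt_one (by positivity)]; linarith)
  filter_upwards [hall] with ω hω
  rw [Metric.tendsto_nhds]
  intro ε hε
  obtain ⟨j, hj⟩ := exists_nat_one_div_lt hε
  filter_upwards [hω j] with n hn
  -- The strict inequality itself forces the mean to be nonzero.
  have hpos : 0 < E n := pos_of_mul_pos_right ((abs_nonneg _).trans_lt hn) (by positivity)
  rw [Real.dist_eq, div_sub_one hpos.ne', abs_div, abs_of_pos hpos, div_lt_iff₀ hpos]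
  refine hn.trans ((mul_lt_mul_iff_left₀ hpos).2 (lt_trans ?_ hj))
  exact one_div_lt_one_div_of_lt (by positivity) (by linarith)
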